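/- Let $(M,g)$ be a smooth four-dimensional spacetime of signature $(-,+,+,+)$ with Levi-Civita connection $\nabla$, and let $u$ be a smooth time-like unit vector field ($g(u,u)=-1$) with expansion $\theta=\nabla\cdot u\neq 0$ everywhere. Let $a=g(\nabla_u u,\cdot)=i(u)\,du$ be its acceleration one-form; write $u$ also for the one-form $g(u,\cdot)$, and $\dot q=u(q)$ for a function $q$. A classical ideal gas (CIG) on an open set $U\subseteq M$ with velocity $u$ and adiabatic index $\gamma$ consists of constants $k,c_v>0$ with $\gamma=1+k/c_v$ and smooth functions on $U$: energy density $\rho$, pressure $p$, matter density $n$, specific internal energy $\epsilon$, specific entropy $s$ and temperature $\Theta$, such that $$dp+\dot p\,u+(\rho+p)a=0,\quad \dot\rho+(\rho+p)\theta=0,\quad \rho=n(1+\epsilon),\quad \dot n+n\theta=0,$$ $$\Theta\,ds=d\epsilon+p\,d(1/n),\quad p=kn\Theta>0,\quad \epsilon=c_v\Theta,\quad \rho+p\neq0 .$$ No sign of $n$ is prescribed here; the gas is called positive if $n>0$ on $U$ (then also $\Theta,\epsilon,\rho>0$). We say that $u$ is the velocity of a CIG at $x\in M$ if there is a CIG with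 velocity $u$ on some open neighbourhood of $x$. A function $f$ on an open set $U$ is called admissible if it is smooth and nowhere zero, is nowhere constant along the flow ($\dot f\neq0$ at every point of $U$), and satisfies $d(\theta u-fa)=0$. For such $f$ put $\tilde\gamma=\frac1f\left(1+\frac{\dot f}{\theta}\right)$. 1. Let $\gamma>1$ and $x\in M$. Then $u$ is the velocity at $x$ of a CIG with adiabatic index $\gamma$ if and only if on some open neighbourhood of $x$ there is an admissible $f$ with $\dot f=\theta[(\gamma-1)f-1]$. 2. Let $x\in M$. Then $u$ is the velocity at $x$ of a CIG (of some adiabatic index) if and only if on some open neighbourhood of $x$ there is an admissible $f$ for which $\tilde\gamma$ is a positive constant. Both equivalences remain true if the gas is required to be positive and $f$ is required to satisfy $\dot f/\theta>0$. 3. For every CIG with velocity $u$ and index $\gamma$ on an open set $U$, the function $f=\frac1\gamma\left(\frac\rho p+1\right)$ is admissible on $U$, $\dot f=\theta[(\gamma-1)f-1]$ and $\tilde\gamma=\gamma-1$ on $U$; and at each point of $U$, $n>0$ if and only if $\dot f/\theta>0$. 4. Let $f$ be admissible on an open set $U$ with $\tilde\gamma$ a positive constant. Every point of $U$ has an open neighbourhood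 $V\subseteq U$ with a smooth function $\psi$ on $V$ such that $d\psi=\theta u-fa$. If $V\subseteq U$ is any connected non-empty open set and $\psi$ any smooth function on $V$ with $d\psi=\theta u-fa$, then functions $\rho,p$ on $V$ are the energy density and pressure of a CIG on $V$ with velocity $u$ and index $\gamma$ such that $f=\frac1\gamma\left(\frac\rho p+1\right)$ if and only if $\gamma=\tilde\gamma+1$ and, for some constant $C>0$, $$p=C\,e^{\gamma\psi},\qquad \rho=p(\gamma f-1)\quad\text{on }V .$$ -/

import Mathlib

open Bundle Set
open scoped Manifold ContDiff Topology

noncomputable section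

section Spacetime

variable {M : Type*} [TopologicalSpace M] [ChartedSpace (EuclideanSpace ℝ (Fin 4)) M]
  [IsManifold (𝓡 4) ∞ M]

/-- A smooth metric tensor of signature `(-,+,+,+)`. -/
structure LorentzMetric (M : Type*) [TopologicalSpace M] [ChartedSpace (EuclideanSpace ℝ (Fin 4)) M]
    [IsManifold (𝓡 4) ∞ M] where
  /-- The metric product on each tangent space. -/
  val (x : M) : TangentSpace (𝓡 4) x →L[ℝ] TangentSpace (𝓡 4) x →L[ℝ] ℝ
  symm (x : M) (v w : TangentSpace (𝓡 4) x) : val x v w = val x w v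
  signature (x : M) : ∃ e : Module.Basis (Fin 4) ℝ (TangentSpace (𝓡 4) x),
    ∀ i j, val x (e i) (e j) = if i = j then (if i = 0 then -1 else 1) else 0
  smooth : ContMDiff (𝓡 4) ((𝓡 4).prod
    𝓘(ℝ, EuclideanSpace ℝ (Fin 4) →L[ℝ] EuclideanSpace ℝ (Fin 4) →L[ℝ] ℝ)) ∞
    (fun x ↦ TotalSpace.mk' (EuclideanSpace ℝ (Fin 4) →L[ℝ] EuclideanSpace ℝ (Fin 4) →L[ℝ] ℝ)
      (E := fun x ↦ TangentSpace (𝓡 4) x →L[ℝ] TangentSpace (𝓡 4) x →L[ℝ] ℝ) x (val x))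

/-- The vector field `X` is differentiable at the point `x`. -/
def IsDifferentiableFieldAt (X : Π x : M, TangentSpace (𝓡 4) x) (x : M) : Prop :=
  MDifferentiableAt (𝓡 4) ((𝓡 4).prod 𝓘(ℝ, EuclideanSpace ℝ (Fin 4)))
    (fun y ↦ TotalSpace.mk' (EuclideanSpace ℝ (Fin 4)) y (X y)) x

/-- `cov` is the Levi-Civita connection of `g`: smooth, torsion-free and metric.
`cov Y x (X x)` is `∇_X Y` at `x`. -/
structure IsLeviCivita (g : LorentzMetric M)
    (cov : CovariantDerivative (𝓡 4) (EuclideanSpace ℝ (Fin 4))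
      (TangentSpace (𝓡 4) : M → Type _)) : Prop where
  smooth : CovariantDerivative.ContMDiffCovariantDerivative cov ∞
  torsion_free : cov.torsion = 0
  metric : ∀ (x : M) (X Y Z : Π y : M, TangentSpace (𝓡 4) y),
    IsDifferentiableFieldAt Y x → IsDifferentiableFieldAt Z x →
      mvfderiv (𝓡 4) (fun y ↦ g.val y (Y y) (Z y)) x (X x) =
        g.val x (cov Y x (X x)) (Z x) + g.val x (Y x) (cov Z x (X x))

/-- A smooth time-like unit vector field. -/
structure IsUnitTimelike (g : LorentzMetric M) (u : Π x : M, TangentSpace (𝓡 4) x) : Prop where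
  smooth : ContMDiff (𝓡 4) ((𝓡 4).prod 𝓘(ℝ, EuclideanSpace ℝ (Fin 4))) ∞
    (fun x ↦ TotalSpace.mk' (EuclideanSpace ℝ (Fin 4)) x (u x))
  unit : ∀ x, g.val x (u x) (u x) = -1

/-- The derivative `q̇ = u(q)` of a function along `u`. -/
def dotDeriv (u : Π x : M, TangentSpace (𝓡 4) x) (q : M → ℝ) (x : M) : ℝ :=
  mvfderiv (𝓡 4) q x (u x)

/-- The expansion `θ = ∇ · u`, the trace of `∇u`. -/
def expansion (cov : CovariantDerivative (𝓡 4) (EuclideanSpace ℝ (Fin 4))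
      (TangentSpace (𝓡 4) : M → Type _))
    (u : Π x : M, TangentSpace (𝓡 4) x) (x : M) : ℝ :=
  LinearMap.trace ℝ (TangentSpace (𝓡 4) x) (cov u x).toLinearMap

/-- The acceleration `a = ∇_u u` as a one-form; for a unit field it is `i(u) du`. -/
def acceleration (g : LorentzMetric M)
    (cov : CovariantDerivative (𝓡 4) (EuclideanSpace ℝ (Fin 4))
      (TangentSpace (𝓡 4) : M → Type _))
    (u : Π x : M, TangentSpace (𝓡 4) x) (x : M) : TangentSpace (𝓡 4) x →L[ℝ] ℝ :=
  g.val x (cov u x (u x))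

/-- The one-form `θ u - f a`, where `u` is identified with the one-form `g(u, ·)`. -/
def kinematicForm (g : LorentzMetric M)
    (cov : CovariantDerivative (𝓡 4) (EuclideanSpace ℝ (Fin 4))
      (TangentSpace (𝓡 4) : M → Type _))
    (u : Π x : M, TangentSpace (𝓡 4) x) (f : M → ℝ) (x : M) :
    TangentSpace (𝓡 4) x →L[ℝ] ℝ :=
  expansion cov u x • g.val x (u x) - f x • acceleration g cov u x

/-- `dα = 0` on `U`, with `dα(X, Y) = X(α(Y)) - Y(α(X)) - α([X, Y])`. -/
def IsClosedFormOn (α : Π x : M, TangentSpace (𝓡 4) x →L[ℝ] ℝ) (U : Set M) : Prop :=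
  ∀ x ∈ U, ∀ X Y : Π y : M, TangentSpace (𝓡 4) y,
    IsDifferentiableFieldAt X x → IsDifferentiableFieldAt Y x →
    mvfderiv (𝓡 4) (fun y ↦ α y (Y y)) x (X x) - mvfderiv (𝓡 4) (fun y ↦ α y (X y)) x (Y x)
      - α x (VectorField.mlieBracket (𝓡 4) X Y x) = 0

/-- The fundamental system of the hydrodynamics of a classical ideal gas on `U`, for the unit
velocity `u`, energy density `ρ`, pressure `p`, matter density `n`, specific internal energy `ε`,
specific entropy `s` and temperature `T`; `k` and `cv` are the constants of the gas.
Only `p` is required to be positive, so `n` and `T` have the same sign. -/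
structure IsClassicalIdealGas (g : LorentzMetric M)
    (cov : CovariantDerivative (𝓡 4) (EuclideanSpace ℝ (Fin 4))
      (TangentSpace (𝓡 4) : M → Type _))
    (u : Π x : M, TangentSpace (𝓡 4) x) (U : Set M) (k cv : ℝ)
    (ρ p n ε s T : M → ℝ) : Prop where
  k_pos : 0 < k
  cv_pos : 0 < cv
  smooth_ρ : ContMDiffOn (𝓡 4) 𝓘(ℝ) ∞ ρ U
  smooth_p : ContMDiffOn (𝓡 4) 𝓘(ℝ) ∞ p U
  smooth_n : ContMDiffOn (𝓡 4) 𝓘(ℝ) ∞ n U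
  smooth_ε : ContMDiffOn (𝓡 4) 𝓘(ℝ) ∞ ε U
  smooth_s : ContMDiffOn (𝓡 4) 𝓘(ℝ) ∞ s U
  smooth_T : ContMDiffOn (𝓡 4) 𝓘(ℝ) ∞ T U
  /-- Momentum conservation `dp + ṗ u + (ρ + p) a = 0`. -/
  momentum : ∀ x ∈ U, mvfderiv (𝓡 4) p x + dotDeriv u p x • g.val x (u x)
    + (ρ x + p x) • acceleration g cov u x = 0
  /-- Energy conservation `ρ̇ + (ρ + p) θ = 0`. -/
  energy : ∀ x ∈ U, dotDeriv u ρ x + (ρ x + p x) * expansion cov u x = 0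
  enthalpy_ne_zero : ∀ x ∈ U, ρ x + p x ≠ 0
  decomposition : ∀ x ∈ U, ρ x = n x * (1 + ε x)
  /-- Conservation of matter `ṅ + n θ = 0`. -/
  matter : ∀ x ∈ U, dotDeriv u n x + n x * expansion cov u x = 0
  /-- Local thermal equilibrium `T ds = dε + p d(1/n)`. -/
  equilibrium : ∀ x ∈ U, T x • mvfderiv (𝓡 4) s x =
    mvfderiv (𝓡 4) ε x + p x • mvfderiv (𝓡 4) (fun y ↦ 1 / n y) x
  state_p : ∀ x ∈ U, p x = k * n x * T x
  p_pos : ∀ x ∈ U, 0 < p x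
  state_ε : ∀ x ∈ U, ε x = cv * T x

/-- On `U`, the hydrodynamic quantities `(u, ρ, p)` and the matter density `n` are those of
some classical ideal gas with adiabatic index `γ = 1 + k / cv`. -/
def IsCIGOn (g : LorentzMetric M)
    (cov : CovariantDerivative (𝓡 4) (EuclideanSpace ℝ (Fin 4))
      (TangentSpace (𝓡 4) : M → Type _))
    (u : Π x : M, TangentSpace (𝓡 4) x) (U : Set M) (γ : ℝ) (ρ p n : M → ℝ) : Prop :=
  ∃ (k cv : ℝ) (ε s T : M → ℝ),
    IsClassicalIdealGas g cov u U k cv ρ p n ε s T ∧ γ = 1 + k / cv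

/-- Near `x`, the field `u` is the velocity of a classical ideal gas with adiabatic index `γ`. -/
def IsCIGVelocityAt (g : LorentzMetric M)
    (cov : CovariantDerivative (𝓡 4) (EuclideanSpace ℝ (Fin 4))
      (TangentSpace (𝓡 4) : M → Type _))
    (u : Π x : M, TangentSpace (𝓡 4) x) (γ : ℝ) (x : M) : Prop :=
  ∃ U : Set M, IsOpen U ∧ x ∈ U ∧ ∃ ρ p n : M → ℝ, IsCIGOn g cov u U γ ρ p n

/-- The same with a positive matter density (hence positive `T`, `ε` and `ρ`). -/
def IsPositiveCIGVelocityAt (g : LorentzMetric M)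
    (cov : CovariantDerivative (𝓡 4) (EuclideanSpace ℝ (Fin 4))
      (TangentSpace (𝓡 4) : M → Type _))
    (u : Π x : M, TangentSpace (𝓡 4) x) (γ : ℝ) (x : M) : Prop :=
  ∃ U : Set M, IsOpen U ∧ x ∈ U ∧ ∃ ρ p n : M → ℝ,
    IsCIGOn g cov u U γ ρ p n ∧ ∀ y ∈ U, 0 < n y

/-- The conditions on `f` on `U` in which no adiabatic index occurs: `f` is smooth, nowhere zero,
nowhere constant along the flow of `u`, and `d(θ u - f a) = 0`. -/
structure IsAdmissibleOn (g : LorentzMetric M)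
    (cov : CovariantDerivative (𝓡 4) (EuclideanSpace ℝ (Fin 4))
      (TangentSpace (𝓡 4) : M → Type _))
    (u : Π x : M, TangentSpace (𝓡 4) x) (U : Set M) (f : M → ℝ) : Prop where
  smooth : ContMDiffOn (𝓡 4) 𝓘(ℝ) ∞ f U
  ne_zero : ∀ x ∈ U, f x ≠ 0
  dot_ne_zero : ∀ x ∈ U, dotDeriv u f x ≠ 0
  closed : IsClosedFormOn (kinematicForm g cov u f) U

/-- `γ̃ = (1/f) (1 + ḟ/θ)`. -/
def gammaTilde
    (cov : CovariantDerivative (𝓡 4) (EuclideanSpace ℝ (Fin 4))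
      (TangentSpace (𝓡 4) : M → Type _))
    (u : Π x : M, TangentSpace (𝓡 4) x) (f : M → ℝ) (x : M) : ℝ :=
  1 / f x * (1 + dotDeriv u f x / expansion cov u x)

end Spacetime

end

/-! ### Differentials of real functions in charts, and the Lie bracket as a commutator. -/

section
variable {E : Type*} [NormedAddCommGroup E] [NormedSpace ℝ E]
  {H : Type*} [TopologicalSpace H] {I : ModelWithCorners ℝ E H}
  {M : Type*} [TopologicalSpace M] [ChartedSpace H M]

/-! The state equations give `n ε = p / (γ - 1)`, hence `n = ρ - p / (γ - 1)`. Conservation of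
energy and of matter then combine to `ṗ = -γ p θ`. With `f = (ρ + p) / (γ p)` the momentum equation
becomes `d log p = γ (θ u - f a)`, so `θ u - f a` is closed (`IsCIGOn.isAdmissibleOn`).
Differentiating `γ f p = ρ + p` along `u` gives `ḟ = θ ((γ - 1) f - 1)`
(`IsCIGOn.dotDeriv_indicatrix`), and `(γ - 1) f - 1` is a positive multiple of `n`, which explains
both `ḟ ≠ 0` and the sign criterion.

Conversely, the Poincaré lemma `IsClosedFormOn.exists_mvfderiv_eq` yields a local `ψ` with `dψ = θ u
- f a`. Since `a(u) = 0` and `g(u, u) = -1`, one has `ψ̇ = -θ`. Then `p = C exp (γ ψ)` and `ρ = p (γ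
f - 1)` satisfy the conservation laws, and `n`, `T`, `s` are read off from the state equations
(`exists_isCIGOn`). On a connected set `log p - γ ψ` is constant, so only `C` is free. -/

theorem HasMFDerivAt.mvfderiv_apply_eq {q : M → ℝ} {x : M} {L : TangentSpace I x →L[ℝ] ℝ}
    (h : HasMFDerivAt I 𝓘(ℝ) q x L) (v : TangentSpace I x) : mvfderiv I q x v = L v :=
  congrArg (fun L : TangentSpace I x →L[ℝ] ℝ ↦ L v) h.mfderiv

theorem mvfderiv_comp_of_hasDerivAt {h : ℝ → ℝ} {h' : ℝ} {q : M → ℝ} {x : M}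
    (hh : HasDerivAt h h' (q x)) (hq : MDifferentiableAt I 𝓘(ℝ) q x) :
    mvfderiv I (fun y ↦ h (q y)) x = h' • mvfderiv I q x := by
  ext v
  refine ((hh.hasFDerivAt.hasMFDerivAt).comp x hq.hasMFDerivAt).mvfderiv_apply_eq v |>.trans ?_
  exact mul_comm _ _

theorem Filter.EventuallyEq.mvfderiv_eq {q q' : M → ℝ} {x : M} (h : q =ᶠ[𝓝 x] q') :
    mvfderiv I q x = mvfderiv I q' x := by
  ext v
  exact congrArg (fun L : TangentSpace I x →L[ℝ] ℝ ↦ L v) h.mfderiv_eq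

section Chart

variable [IsManifold I 1 M]

theorem mvfderiv_apply_of_eventuallyEq_comp_extChartAt {q : M → ℝ} {h : E → ℝ} {x₀ y : M}
    (hy : y ∈ (extChartAt I x₀).source) (hh : DifferentiableAt ℝ h (extChartAt I x₀ y))
    (hq : q =ᶠ[𝓝 y] h ∘ extChartAt I x₀) (v : TangentSpace I y) :
    mvfderiv I q y v = fderiv ℝ h (extChartAt I x₀ y)
      (mfderiv I 𝓘(ℝ, E) (extChartAt I x₀) y v) := by
  rw [hq.mvfderiv_eq]
  have hy' : y ∈ (chartAt H x₀).source := by rwa [extChartAt_source] at hy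
  exact ((hh.hasFDerivAt.hasMFDerivAt).comp y
    (mdifferentiableAt_extChartAt hy').hasMFDerivAt).mvfderiv_apply_eq v

omit [IsManifold I 1 M] in
theorem eventuallyEq_comp_extChartAt_symm {F : Type*} (q : M → F) {x₀ y : M}
    (hy : y ∈ (extChartAt I x₀).source) :
    q =ᶠ[𝓝 y] (q ∘ (extChartAt I x₀).symm) ∘ extChartAt I x₀ := by
  filter_upwards [extChartAt_source_mem_nhds' hy] with z hz
  exact congrArg q ((extChartAt I x₀).left_inv hz).symm

variable [I.Boundaryless]

omit [IsManifold I 1 M] in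
theorem ContMDiffAt.contDiffAt_comp_extChartAt_symm {n : ℕ∞ω} [IsManifold I n M] {q : M → ℝ}
    {x₀ y : M} (hy : y ∈ (extChartAt I x₀).source) (hq : ContMDiffAt I 𝓘(ℝ) n q y) :
    ContDiffAt ℝ n (q ∘ (extChartAt I x₀).symm) (extChartAt I x₀ y) := by
  have h := (contMDiffAt_iff_of_mem_source (x' := y) (y := q y) (x := x₀)
    (by rwa [extChartAt_source] at hy) (by simp)).1 hq
  simpa [I.range_eq_univ, contDiffWithinAt_univ] using! h.2

theorem mvfderiv_apply_eq_fderiv {q : M → ℝ} {x₀ y : M} (hy : y ∈ (extChartAt I x₀).source)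
    (hq : ContMDiffAt I 𝓘(ℝ) 1 q y) (v : TangentSpace I y) :
    mvfderiv I q y v = fderiv ℝ (q ∘ (extChartAt I x₀).symm) (extChartAt I x₀ y)
      (mfderiv I 𝓘(ℝ, E) (extChartAt I x₀) y v) :=
  mvfderiv_apply_of_eventuallyEq_comp_extChartAt hy
    ((hq.contDiffAt_comp_extChartAt_symm hy).differentiableAt one_ne_zero)
    (eventuallyEq_comp_extChartAt_symm q hy) v

end Chart

/-- In a chart the second derivatives of `q` cancel by symmetry, which is why `q` must be C². The
work is to carry the fields, the bracket and the differential to the chart. -/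
theorem mvfderiv_mlieBracket [IsManifold I 2 M] [I.Boundaryless] [CompleteSpace E]
    {q : M → ℝ} {x : M} (hq : ContMDiffAt I 𝓘(ℝ) 2 q x)
    {X Y : Π y : M, TangentSpace I y}
    (hX : MDifferentiableAt I (I.prod 𝓘(ℝ, E)) (fun y ↦ (TotalSpace.mk' E y (X y))) x)
    (hY : MDifferentiableAt I (I.prod 𝓘(ℝ, E)) (fun y ↦ (TotalSpace.mk' E y (Y y))) x) :
    mvfderiv I q x (VectorField.mlieBracket I X Y x) =
      mvfderiv I (fun y ↦ mvfderiv I q y (Y y)) x (X x) -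
      mvfderiv I (fun y ↦ mvfderiv I q y (X y)) x (Y x) := by
  have : IsManifold I 1 M := .of_le (n := 2) (by norm_num)
  set φ := extChartAt I x
  have hx : x ∈ φ.source := mem_extChartAt_source x
  set q' : E → ℝ := q ∘ φ.symm
  have hq' : ContDiffAt ℝ 2 q' (φ x) := hq.contDiffAt_comp_extChartAt_symm hx
  let P (Z : Π y : M, TangentSpace I y) : E → E :=
    VectorField.mpullbackWithin 𝓘(ℝ, E) I φ.symm Z (range I)
  have hP : ∀ {Z : Π y : M, TangentSpace I y},
      MDifferentiableAt I (I.prod 𝓘(ℝ, E)) (fun y ↦ (TotalSpace.mk' E y (Z y))) x →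
      DifferentiableAt ℝ (P Z) (φ x) := by
    intro Z hZ
    have := (mdifferentiableWithinAt_univ.2
      hZ).differentiableWithinAt_mpullbackWithin_vectorField
    change DifferentiableWithinAt ℝ (P Z) (φ.symm ⁻¹' univ ∩ range I) (φ x) at this
    rwa [preimage_univ, univ_inter, I.range_eq_univ, differentiableWithinAt_univ] at this
  -- Pulling back along the inverse chart applies the inverse of `d(φ⁻¹)`, which is `dφ`.
  have hPφ : ∀ (Z : Π y : M, TangentSpace I y), ∀ y ∈ φ.source,
      P Z (φ y) = mfderiv I 𝓘(ℝ, E) φ y (Z y) := by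
    intro Z y hy
    have h1 := mfderivWithin_extChartAt_symm_comp_mfderiv_extChartAt' hy
    have h2 := mfderiv_extChartAt_comp_mfderivWithin_extChartAt_symm' hy
    have h3 := ContinuousLinearMap.inverse_eq h1 h2
    change (mfderivWithin 𝓘(ℝ, E) I φ.symm (range I) (φ y)).inverse (Z (φ.symm (φ y))) = _
    rw [φ.left_inv hy]
    exact congrArg (fun L : TangentSpace I y →L[ℝ] E ↦ L (Z y)) h3
  have hdq : DifferentiableAt ℝ (fderiv ℝ q') (φ x) :=
    (hq'.fderiv_right (m := 1) (by norm_num)).differentiableAt one_ne_zero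
  have key : ∀ {Z : Π y : M, TangentSpace I y}, DifferentiableAt ℝ (P Z) (φ x) →
      ∀ v, mvfderiv I (fun y ↦ mvfderiv I q y (Z y)) x v =
        fderiv ℝ (fun z ↦ fderiv ℝ q' z (P Z z)) (φ x) (mfderiv I 𝓘(ℝ, E) φ x v) := by
    intro Z hZ v
    refine mvfderiv_apply_of_eventuallyEq_comp_extChartAt hx (hdq.clm_apply hZ) ?_ v
    filter_upwards [(contMDiffAt_iff_contMDiffAt_nhds (by simp)).1 (hq.of_le (m := 1) (by norm_num)),
      extChartAt_source_mem_nhds (I := I) x] with y hqy hy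
    rw [mvfderiv_apply_eq_fderiv hy hqy, ← hPφ Z y hy]
    rfl
  rw [key (hP hX), key (hP hY), ← hPφ X x hx, ← hPφ Y x hx,
    ← VectorField.fderiv_apply_lieBracket hq' (by simp) (hP hY) (hP hX),
    mvfderiv_apply_eq_fderiv hx (hq.of_le (by norm_num))]
  congr 1
  -- The manifold bracket is by definition `(dφ)⁻¹` of the bracket in the chart, so `dφ` cancels.
  rw [← VectorField.mlieBracketWithin_univ, VectorField.mlieBracketWithin_apply]
  have hB : VectorField.lieBracketWithin ℝ (P X) (P Y) (φ.symm ⁻¹' univ ∩ range I) (φ x) =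
      VectorField.lieBracket ℝ (P X) (P Y) (φ x) := by
    rw [preimage_univ, univ_inter, I.range_eq_univ, VectorField.lieBracketWithin_univ]
  exact (congrArg (fun L : E →L[ℝ] E ↦ L (VectorField.lieBracketWithin ℝ (P X) (P Y)
    (φ.symm ⁻¹' univ ∩ range I) (φ x))) (isInvertible_mfderiv_extChartAt hx).self_comp_inverse).trans hB

end
-- Local constancy of functions with vanishing differential.
section
variable {E : Type*} [NormedAddCommGroup E] [NormedSpace ℝ E]
  {H : Type*} [TopologicalSpace H] {I : ModelWithCorners ℝ E H} [I.Boundaryless]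
  {M : Type*} [TopologicalSpace M] [ChartedSpace H M]

theorem IsOpen.exists_ball_extChartAt {U : Set M} (hU : IsOpen U) {x : M} (hx : x ∈ U) :
    ∃ r > 0, Metric.ball (extChartAt I x x) r ⊆ (extChartAt I x).target ∧
      ∀ z ∈ Metric.ball (extChartAt I x x) r, (extChartAt I x).symm z ∈ U := by
  have h1 := extChartAt_target_mem_nhds (I := I) x
  have h2 : ContinuousAt (extChartAt I x).symm (extChartAt I x x) := continuousAt_extChartAt_symm x
  have h3 := h2 (hU.mem_nhds (by simpa using hx))
  obtain ⟨r, hr, h⟩ := Metric.mem_nhds_iff.1 (Filter.inter_mem h1 h3)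
  exact ⟨r, hr, fun z hz ↦ (h hz).1, fun z hz ↦ (h hz).2⟩

omit [I.Boundaryless] in
theorem isOpen_extChartAt_source_inter_preimage (x : M) {s : Set E} (hs : IsOpen s) :
    IsOpen ((extChartAt I x).source ∩ extChartAt I x ⁻¹' s) :=
  (continuousOn_extChartAt x).isOpen_inter_preimage (isOpen_extChartAt_source x) hs

/-- A function with vanishing differential on a preconnected open set is constant there. -/
theorem IsOpen.eq_of_mvfderiv_eq_zero [IsManifold I 1 M] {V : Set M} (hV : IsOpen V) (hVc : IsPreconnected V)
    {q : M → ℝ} (hq : ∀ y ∈ V, ContMDiffAt I 𝓘(ℝ) 1 q y)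
    (hq' : ∀ y ∈ V, mvfderiv I q y = 0) {x y : M} (hx : x ∈ V) (hy : y ∈ V) : q x = q y := by
  -- Equality of values is an equivalence relation, so on a preconnected set it need only be checked
  -- near each point; there a convex ball in the chart suffices.
  refine hVc.induction₂ (fun x y ↦ q x = q y) (fun x hx ↦ ?_)
    (fun _ _ _ _ _ _ h1 h2 ↦ h1.trans h2) (fun _ _ _ _ h ↦ h.symm) hx hy
  obtain ⟨r, hr, hball, hrV⟩ := hV.exists_ball_extChartAt (I := I) hx
  refine nhdsWithin_le_nhds ?_
  filter_upwards [(isOpen_extChartAt_source_inter_preimage (I := I) x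
    (Metric.isOpen_ball (x := extChartAt I x x) (ε := r))).mem_nhds ⟨by simp, by simpa using hr⟩]
    with y hy
  have hd : ∀ z ∈ Metric.ball (extChartAt I x x) r,
      HasFDerivAt (q ∘ (extChartAt I x).symm) (0 : E →L[ℝ] ℝ) z := by
    intro z hz
    have hz' := (extChartAt I x).map_target (hball hz)
    have hq1 := hq _ (hrV z hz)
    have h1 := (hq1.contDiffAt_comp_extChartAt_symm hz').differentiableAt one_ne_zero
    rw [(extChartAt I x).right_inv (hball hz)] at h1
    refine (?_ : fderiv ℝ (q ∘ (extChartAt I x).symm) z = 0) ▸ h1.hasFDerivAt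
    ext v
    -- Every model vector `v` is the image under the chart differential of a tangent vector.
    have h2 := mvfderiv_apply_eq_fderiv hz' hq1
      ((mfderiv I 𝓘(ℝ, E) (extChartAt I x) ((extChartAt I x).symm z)).inverse v)
    have h3 := (isInvertible_mfderiv_extChartAt hz').self_apply_inverse v
    rw [hq' _ (hrV z hz), h3, (extChartAt I x).right_inv (hball hz)] at h2
    exact h2.symm
  have := (convex_ball (extChartAt I x x) r).is_const_of_fderivWithin_eq_zero (𝕜 := ℝ)
    (fun z hz ↦ (hd z hz).differentiableAt.differentiableWithinAt)
    (fun z hz ↦ by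
      rw [fderivWithin_of_isOpen Metric.isOpen_ball hz, (hd z hz).fderiv])
    (Metric.mem_ball_self hr) hy.2
  rwa [Function.comp_apply, Function.comp_apply, extChartAt_to_inv,
    (extChartAt I x).left_inv hy.1] at this

end

/-! ### The Poincaré lemma on a chart ball. -/

section
variable {M : Type*} [TopologicalSpace M] [ChartedSpace (EuclideanSpace ℝ (Fin 4)) M]
  [IsManifold (𝓡 4) ∞ M]

/-- Pulled back by a chart, this makes coordinate fields commute. -/
theorem VectorField.mlieBracket_const_modelSpace {E : Type*} [NormedAddCommGroup E]
    [NormedSpace ℝ E] (v w z : E) :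
    VectorField.mlieBracket 𝓘(ℝ, E) (fun x ↦ (v : TangentSpace 𝓘(ℝ, E) x))
      (fun x ↦ (w : TangentSpace 𝓘(ℝ, E) x)) z = 0 := by
  have h := congrFun (VectorField.mlieBracketWithin_eq_lieBracketWithin (𝕜 := ℝ) (s := univ)
    (V := fun x ↦ (v : TangentSpace 𝓘(ℝ, E) x)) (W := fun x ↦ (w : TangentSpace 𝓘(ℝ, E) x))) z
  refine (congrFun VectorField.mlieBracketWithin_univ z).symm.trans (h.trans ?_)
  have h2 : VectorField.lieBracketWithin ℝ (fun _ : E ↦ v) (fun _ : E ↦ w) univ z = 0 := by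
    simp [VectorField.lieBracketWithin_univ, VectorField.lieBracket]
  exact h2

/-- Poincaré lemma for one-forms. -/
theorem IsClosedFormOn.exists_mvfderiv_eq {α : Π x : M, TangentSpace (𝓡 4) x →L[ℝ] ℝ} {U : Set M}
    (hc : IsClosedFormOn α U) (hU : IsOpen U)
    (hα : ∀ y ∈ U, ∀ X : Π y : M, TangentSpace (𝓡 4) y,
      ContMDiffAt (𝓡 4) ((𝓡 4).prod 𝓘(ℝ, EuclideanSpace ℝ (Fin 4))) ∞
        (fun y ↦ TotalSpace.mk' (EuclideanSpace ℝ (Fin 4)) y (X y)) y →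
      ContMDiffAt (𝓡 4) 𝓘(ℝ) ∞ (fun y ↦ α y (X y)) y) {x : M} (hx : x ∈ U) :
    ∃ V : Set M, IsOpen V ∧ x ∈ V ∧ V ⊆ U ∧ ∃ ψ : M → ℝ, ContMDiffOn (𝓡 4) 𝓘(ℝ) ∞ ψ V ∧
      ∀ y ∈ V, mvfderiv (𝓡 4) ψ y = α y := by
  set φ := extChartAt (𝓡 4) x with hφ
  let E := EuclideanSpace ℝ (Fin 4)
  obtain ⟨r, hr, hball, hrU⟩ := hU.exists_ball_extChartAt (I := 𝓡 4) hx
  rw [← hφ] at hball hrU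
  set B : Set E := Metric.ball (φ x) r with hB
  have hBo : IsOpen B := Metric.isOpen_ball
  -- Coordinate fields: `X w` has the constant expression `w` in the chart. As their brackets
  -- vanish, closedness of `α` on them says exactly that the derivative of the chart form `β` is
  -- symmetric.
  let X (w : E) : Π y : M, TangentSpace (𝓡 4) y :=
    VectorField.mpullback (𝓡 4) 𝓘(ℝ, E) φ (fun _ ↦ w)
  have hφX : ∀ w, ∀ y ∈ φ.source, mfderiv (𝓡 4) 𝓘(ℝ, E) φ y (X w y) = w := fun w y hy ↦
    (isInvertible_mfderiv_extChartAt hy).self_apply_inverse w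
  have hconst : ∀ w z, ContMDiffAt 𝓘(ℝ, E) (𝓘(ℝ, E).prod 𝓘(ℝ, E)) ∞
      (fun z : E ↦ (TotalSpace.mk' E z w : TangentBundle 𝓘(ℝ, E) E)) z := fun w z ↦
    contMDiffAt_vectorSpace_iff_contDiffAt.2 contDiffAt_const
  have hX : ∀ w, ∀ y ∈ φ.source, ContMDiffAt (𝓡 4) ((𝓡 4).prod 𝓘(ℝ, E)) ∞
      (fun y ↦ TotalSpace.mk' E y (X w y)) y := fun w y hy ↦
    ContMDiffAt.mpullback_vectorField_preimage (n := ∞) (hconst w (φ y))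
      (contMDiffAt_extChartAt' (by rwa [← extChartAt_source (𝓡 4)]))
      (isInvertible_mfderiv_extChartAt hy) ENat.coe_top_add_one.le
  let β : E → E →L[ℝ] ℝ := fun z ↦
    (α (φ.symm z)).comp (mfderiv (𝓡 4) 𝓘(ℝ, E) φ (φ.symm z)).inverse
  have hαX : ∀ w, ∀ z ∈ B, ContMDiffAt (𝓡 4) 𝓘(ℝ) ∞ (fun y ↦ α y (X w y)) (φ.symm z) :=
    fun w z hz ↦ hα _ (hrU z hz) _ (hX w _ (φ.map_target (hball hz)))
  have hβd : ContDiffOn ℝ ∞ β B := by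
    -- In finite dimension it suffices to test `β` on each fixed vector, where it becomes `α (X w)`
    -- read in the chart.
    refine contDiffOn_clm_apply.2 fun w z hz ↦ ContDiffAt.contDiffWithinAt ?_
    have h := (hαX w z hz).contDiffAt_comp_extChartAt_symm (x₀ := x) (φ.map_target (hball hz))
    rwa [← hφ, φ.right_inv (hball hz)] at h
  have hβ1 : DifferentiableOn ℝ β B := hβd.differentiableOn (by simp)
  have hderiv : ∀ v w, ∀ z ∈ B, mvfderiv (𝓡 4) (fun y ↦ α y (X w y)) (φ.symm z) (X v (φ.symm z)) =
      fderiv ℝ β z v w := by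
    intro v w z hz
    have hz' := φ.map_target (hball hz)
    rw [mvfderiv_apply_eq_fderiv hz' ((hαX w z hz).of_le (by simp)), ← hφ, hφX v _ hz',
      φ.right_inv (hball hz)]
    have h := (hβ1.differentiableAt (hBo.mem_nhds hz)).hasFDerivAt.clm_apply (hasFDerivAt_const w z)
    refine (congrArg (fun L : E →L[ℝ] ℝ ↦ L v) h.fderiv).trans ?_
    simp
  have : IsManifold (𝓡 4) (minSmoothness ℝ 2) M := by
    rw [minSmoothness_of_isRCLikeNormedField]
    infer_instance
  have hbr : ∀ v w, ∀ y ∈ φ.source, VectorField.mlieBracket (𝓡 4) (X v) (X w) y = 0 := by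
    intro v w y hy
    have h := VectorField.mpullback_mlieBracket (f := φ) (x₀ := y) (n := ∞)
      ((hconst v (φ y)).mdifferentiableAt (by simp))
      ((hconst w (φ y)).mdifferentiableAt (by simp))
      (contMDiffAt_extChartAt' (I := 𝓡 4) (by rwa [← extChartAt_source (𝓡 4)]))
      (by rw [minSmoothness_of_isRCLikeNormedField]; exact WithTop.coe_le_coe.2 le_top)
    refine h.symm.trans ?_
    rw [VectorField.mpullback_apply]
    refine (congrArg _ (VectorField.mlieBracket_const_modelSpace v w (φ y))).trans (map_zero _)
  obtain ⟨ψ', hψ'⟩ := (convex_ball (φ x) r).exists_forall_hasFDerivAt_of_fderiv_symmetric hBo hβ1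
    (by
      intro z hz v w
      have hz' := φ.map_target (hball hz)
      have h := hc _ (hrU z hz) (X v) (X w) ((hX v _ hz').mdifferentiableAt (by simp))
        ((hX w _ hz').mdifferentiableAt (by simp))
      rw [hderiv v w z hz, hderiv w v z hz, hbr v w _ hz', map_zero, sub_zero] at h
      exact sub_eq_zero.1 h)
  have hψ's : ContDiffOn ℝ ∞ ψ' B := (contDiffOn_infty_iff_fderiv_of_isOpen hBo).2
    ⟨fun z hz ↦ (hψ' z hz).differentiableAt.differentiableWithinAt,
      hβd.congr fun z hz ↦ (hψ' z hz).fderiv⟩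
  refine ⟨φ.source ∩ φ ⁻¹' B, isOpen_extChartAt_source_inter_preimage x hBo,
    ⟨mem_extChartAt_source x, Metric.mem_ball_self hr⟩, ?_, ψ' ∘ φ, ?_, ?_⟩
  · intro y hy
    simpa [φ.left_inv hy.1] using hrU _ hy.2
  · intro y hy
    refine ContMDiffAt.contMDiffWithinAt ?_
    exact (hψ's.contDiffAt (hBo.mem_nhds hy.2)).contMDiffAt.comp y
      (contMDiffAt_extChartAt' (by rw [← extChartAt_source (𝓡 4)]; exact hy.1))
  · intro y hy
    ext v
    rw [mvfderiv_apply_of_eventuallyEq_comp_extChartAt (x₀ := x) hy.1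
      (hψ' _ hy.2).differentiableAt .rfl, (hψ' _ hy.2).fderiv]
    have h := (isInvertible_mfderiv_extChartAt (I := 𝓡 4) hy.1).inverse_apply_self v
    change α (φ.symm (φ y)) ((mfderiv (𝓡 4) 𝓘(ℝ, E) φ (φ.symm (φ y))).inverse
      (mfderiv (𝓡 4) 𝓘(ℝ, E) φ y v)) = _
    rw [φ.left_inv hy.1]
    exact congrArg (α y) h

end
-- Smoothness of the kinematic quantities, and closedness of exact forms.
section
variable {M : Type*} [TopologicalSpace M] [ChartedSpace (EuclideanSpace ℝ (Fin 4)) M]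
  [IsManifold (𝓡 4) ∞ M]

/-- Smoothness of a vector field at a point. -/
abbrev IsSmoothFieldAt (X : Π x : M, TangentSpace (𝓡 4) x) (x : M) : Prop :=
  ContMDiffAt (𝓡 4) ((𝓡 4).prod 𝓘(ℝ, EuclideanSpace ℝ (Fin 4))) ∞
    (fun y ↦ TotalSpace.mk' (EuclideanSpace ℝ (Fin 4)) y (X y)) x

variable {g : LorentzMetric M}
    {cov : CovariantDerivative (𝓡 4) (EuclideanSpace ℝ (Fin 4)) (TangentSpace (𝓡 4) : M → Type _)}
    {u : Π x : M, TangentSpace (𝓡 4) x}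

theorem LorentzMetric.contMDiffAt_val (g : LorentzMetric M) {X Y : Π x : M, TangentSpace (𝓡 4) x}
    {x : M} (hX : IsSmoothFieldAt X x) (hY : IsSmoothFieldAt Y x) :
    ContMDiffAt (𝓡 4) 𝓘(ℝ) ∞ (fun y ↦ g.val y (X y) (Y y)) x := by
  have : ContMDiffAt (𝓡 4) ((𝓡 4).prod 𝓘(ℝ)) ∞
      (fun m ↦ TotalSpace.mk' ℝ (E := Bundle.Trivial M ℝ) m (g.val m (X m) (Y m))) x := by
    apply ContMDiffAt.clm_bundle_apply₂ (F₁ := EuclideanSpace ℝ (Fin 4))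
      (F₂ := EuclideanSpace ℝ (Fin 4))
    · exact g.smooth.contMDiffAt
    · exact hX
    · exact hY
  simp only [contMDiffAt_totalSpace] at this
  exact this.2

theorem IsLeviCivita.contMDiffAt_cov (hcov : IsLeviCivita g cov) (hu : IsUnitTimelike g u) (x : M) :
    ContMDiffAt (𝓡 4) ((𝓡 4).prod 𝓘(ℝ, EuclideanSpace ℝ (Fin 4) →L[ℝ] EuclideanSpace ℝ (Fin 4))) ∞
      (fun y ↦ (⟨y, cov u y⟩ : TotalSpace (EuclideanSpace ℝ (Fin 4) →L[ℝ] EuclideanSpace ℝ (Fin 4))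
        fun y ↦ TangentSpace (𝓡 4) y →L[ℝ] TangentSpace (𝓡 4) y)) x := by
  have h := hcov.smooth.contMDiff.contMDiff (σ := u)
    (by rw [ENat.coe_top_add_one]; exact hu.smooth.contMDiffOn)
  exact h.contMDiffAt Filter.univ_mem

theorem IsLeviCivita.isSmoothFieldAt_cov_self (hcov : IsLeviCivita g cov)
    (hu : IsUnitTimelike g u) (x : M) : IsSmoothFieldAt (fun y ↦ cov u y (u y)) x :=
  (hcov.contMDiffAt_cov hu x).clm_bundle_apply hu.smooth.contMDiffAt

/-- The trace is invariant under conjugation, so locally the expansion is a fixed linear functional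
of the coordinate expression of `∇u`. -/
theorem IsLeviCivita.contMDiff_expansion (hcov : IsLeviCivita g cov)
    (hu : IsUnitTimelike g u) : ContMDiff (𝓡 4) 𝓘(ℝ) ∞ (expansion cov u) := by
  intro x
  have h := ((contMDiffAt_hom_bundle _).1 (hcov.contMDiffAt_cov hu x)).2
  let tr : (EuclideanSpace ℝ (Fin 4) →L[ℝ] EuclideanSpace ℝ (Fin 4)) →L[ℝ] ℝ :=
    LinearMap.toContinuousLinearMap
      ((LinearMap.trace ℝ (EuclideanSpace ℝ (Fin 4))).comp (ContinuousLinearMap.coeLM ℝ))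
  have h2 := tr.contMDiff.contMDiffAt.comp x h
  refine h2.congr_of_eventuallyEq ?_
  filter_upwards [(trivializationAt (EuclideanSpace ℝ (Fin 4)) (TangentSpace (𝓡 4) : M → Type _)
    x).open_baseSet.mem_nhds (FiberBundle.mem_baseSet_trivializationAt' x)] with y hy
  have h3 := ContinuousLinearMap.inCoordinates_eq (ϕ := cov u y) hy hy
  simp only [Function.comp_apply, h3]
  exact (LinearMap.trace_conj' _ (((trivializationAt (EuclideanSpace ℝ (Fin 4))
    (TangentSpace (𝓡 4) : M → Type _) x).continuousLinearEquivAt ℝ y hy).toLinearEquiv)).symm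

/-- Differentiate `g(u, u) = -1` along `u`. -/
theorem IsLeviCivita.acceleration_self (hcov : IsLeviCivita g cov) (hu : IsUnitTimelike g u)
    (x : M) : acceleration g cov u x (u x) = 0 := by
  have hd : IsDifferentiableFieldAt u x := hu.smooth.mdifferentiableAt (by simp)
  have h := hcov.metric x u u u hd hd
  simp only [hu.unit, mvfderiv_const] at h
  rw [g.symm x (u x)] at h
  change (0 : ℝ) = _ at h
  change g.val x (cov u x (u x)) (u x) = 0
  linarith

/-- It gives `ψ̇ = -θ` for every potential `ψ`, whatever `f` is. -/
theorem IsLeviCivita.kinematicForm_self (hcov : IsLeviCivita g cov) (hu : IsUnitTimelike g u)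
    (f : M → ℝ) (x : M) : kinematicForm g cov u f x (u x) = - expansion cov u x := by
  simp [kinematicForm, hcov.acceleration_self hu, hu.unit]

theorem IsLeviCivita.contMDiffAt_kinematicForm (hcov : IsLeviCivita g cov)
    (hu : IsUnitTimelike g u) {f : M → ℝ} {X : Π x : M, TangentSpace (𝓡 4) x} {x : M}
    (hf : ContMDiffAt (𝓡 4) 𝓘(ℝ) ∞ f x) (hX : IsSmoothFieldAt X x) :
    ContMDiffAt (𝓡 4) 𝓘(ℝ) ∞ (fun y ↦ kinematicForm g cov u f y (X y)) x := by
  exact ((hcov.contMDiff_expansion hu x).mul (g.contMDiffAt_val hu.smooth.contMDiffAt hX)).sub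
    (hf.mul (g.contMDiffAt_val (hcov.isSmoothFieldAt_cov_self hu x) hX))

theorem isClosedFormOn_of_mvfderiv_eq {α : Π x : M, TangentSpace (𝓡 4) x →L[ℝ] ℝ} {U : Set M}
    (hU : IsOpen U) {ψ : M → ℝ} (hψ : ContMDiffOn (𝓡 4) 𝓘(ℝ) ∞ ψ U)
    (h : ∀ y ∈ U, mvfderiv (𝓡 4) ψ y = α y) : IsClosedFormOn α U := by
  intro x hx X Y hX hY
  have hψx : ContMDiffAt (𝓡 4) 𝓘(ℝ) 2 ψ x :=
    (hψ.contMDiffAt (hU.mem_nhds hx)).of_le (WithTop.coe_le_coe.2 le_top)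
  have hb := mvfderiv_mlieBracket hψx hX hY
  have hZ : ∀ Z : Π y : M, TangentSpace (𝓡 4) y,
      (fun y ↦ α y (Z y)) =ᶠ[𝓝 x] fun y ↦ mvfderiv (𝓡 4) ψ y (Z y) := fun Z ↦ by
    filter_upwards [hU.mem_nhds hx] with y hy
    rw [h y hy]
  rw [(hZ X).mvfderiv_eq, (hZ Y).mvfderiv_eq, ← h x hx, hb, sub_self]

end
-- From a gas to its indicatrix function, and back.
section
variable {M : Type*} [TopologicalSpace M] [ChartedSpace (EuclideanSpace ℝ (Fin 4)) M]
  [IsManifold (𝓡 4) ∞ M] {g : LorentzMetric M}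
    {cov : CovariantDerivative (𝓡 4) (EuclideanSpace ℝ (Fin 4)) (TangentSpace (𝓡 4) : M → Type _)}
    {u : Π x : M, TangentSpace (𝓡 4) x} {U : Set M} {γ : ℝ} {ρ p n f ψ : M → ℝ}

omit [IsManifold (𝓡 4) ∞ M] in
theorem ContMDiffOn.mdifferentiableAt_of_isOpen {q : M → ℝ} (hq : ContMDiffOn (𝓡 4) 𝓘(ℝ) ∞ q U)
    (hU : IsOpen U) {y : M} (hy : y ∈ U) : MDifferentiableAt (𝓡 4) 𝓘(ℝ) q y :=
  (hq.contMDiffAt (hU.mem_nhds hy)).mdifferentiableAt (by simp)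

omit [IsManifold (𝓡 4) ∞ M] in
theorem mvfderiv_const_mul {q : M → ℝ} {y : M} (c : ℝ) (hq : MDifferentiableAt (𝓡 4) 𝓘(ℝ) q y) :
    mvfderiv (𝓡 4) (fun z ↦ c * q z) y = c • mvfderiv (𝓡 4) q y :=
  mvfderiv_comp_of_hasDerivAt (h := fun t ↦ c * t)
    (by simpa using (hasDerivAt_id (q y)).const_mul c) hq

theorem IsCIGOn.one_lt (h : IsCIGOn g cov u U γ ρ p n) : 1 < γ := by
  obtain ⟨k, cv, ε, s, T, h, rfl⟩ := h
  have := div_pos h.k_pos h.cv_pos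
  linarith

/-- The internal energy per volume is `n ε = cv n T = (cv / k) p`. This eliminates the thermodynamic
variables. -/
theorem IsCIGOn.matter_eq (h : IsCIGOn g cov u U γ ρ p n) {y : M} (hy : y ∈ U) :
    n y = ρ y - p y / (γ - 1) := by
  obtain ⟨k, cv, ε, s, T, h, rfl⟩ := h
  have hk := h.k_pos
  have hc := h.cv_pos
  rw [h.decomposition y hy, h.state_p y hy, h.state_ε y hy, add_sub_cancel_left]
  field_simp
  ring

theorem IsCIGOn.matter_ne_zero (h : IsCIGOn g cov u U γ ρ p n) {y : M} (hy : y ∈ U) :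
    n y ≠ 0 := by
  obtain ⟨k, cv, ε, s, T, h, rfl⟩ := h
  intro h0
  have h1 := h.p_pos y hy
  rw [h.state_p y hy, h0] at h1
  simp at h1

/-- Adiabatic evolution `ṗ = -γ p θ` of the pressure. -/
theorem IsCIGOn.dotDeriv_pressure (h : IsCIGOn g cov u U γ ρ p n) (hU : IsOpen U) {y : M}
    (hy : y ∈ U) : dotDeriv u p y = - (γ * p y * expansion cov u y) := by
  have hγ := h.one_lt
  have hn : n =ᶠ[𝓝 y] fun z ↦ ρ z - (γ - 1)⁻¹ * p z := by
    filter_upwards [hU.mem_nhds hy] with z hz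
    rw [h.matter_eq hz]
    ring
  have hny := h.matter_eq hy
  obtain ⟨k, cv, ε, s, T, h, -⟩ := h
  have hp := h.smooth_p.mdifferentiableAt_of_isOpen hU hy
  have hρ := h.smooth_ρ.mdifferentiableAt_of_isOpen hU hy
  have h1 := h.matter y hy
  have h2 := h.energy y hy
  have hcp : MDifferentiableAt (𝓡 4) 𝓘(ℝ) (fun z ↦ (γ - 1)⁻¹ * p z) y :=
    mdifferentiableAt_const.mul hp
  have h3 : dotDeriv u n y = dotDeriv u ρ y - (γ - 1)⁻¹ * dotDeriv u p y := by
    rw [dotDeriv, hn.mvfderiv_eq, mvfderiv_fun_sub hρ hcp, mvfderiv_const_mul _ hp]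
    rfl
  rw [h3, hny] at h1
  have hγ' : γ - 1 ≠ 0 := by linarith
  field_simp at h1
  linear_combination (γ - 1) * h2 - h1

/-- This is the momentum equation after inserting `ṗ = -γ p θ` and `ρ + p = γ p f`. -/
theorem IsCIGOn.mvfderiv_pressure (h : IsCIGOn g cov u U γ ρ p n) (hU : IsOpen U)
    (hf : ∀ y ∈ U, f y = 1 / γ * (ρ y / p y + 1)) {y : M} (hy : y ∈ U) :
    mvfderiv (𝓡 4) p y = (γ * p y) • kinematicForm g cov u f y := by
  have hγ := h.one_lt
  have h1 := h.dotDeriv_pressure hU hy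
  obtain ⟨k, cv, ε, s, T, h, -⟩ := h
  have hp := h.p_pos y hy
  have h2 := h.momentum y hy
  have h3 : γ * p y * f y = ρ y + p y := by
    rw [hf y hy]
    field_simp
  rw [kinematicForm, smul_sub, smul_smul, smul_smul, h3]
  rw [h1, add_assoc] at h2
  rw [eq_neg_of_add_eq_zero_left h2]
  module

theorem IsCIGOn.smooth_pressure (h : IsCIGOn g cov u U γ ρ p n) :
    ContMDiffOn (𝓡 4) 𝓘(ℝ) ∞ p U := by
  obtain ⟨k, cv, ε, s, T, h, -⟩ := h
  exact h.smooth_p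

theorem IsCIGOn.smooth_density (h : IsCIGOn g cov u U γ ρ p n) :
    ContMDiffOn (𝓡 4) 𝓘(ℝ) ∞ ρ U := by
  obtain ⟨k, cv, ε, s, T, h, -⟩ := h
  exact h.smooth_ρ

theorem IsCIGOn.pressure_pos (h : IsCIGOn g cov u U γ ρ p n) {y : M} (hy : y ∈ U) : 0 < p y := by
  obtain ⟨k, cv, ε, s, T, h, -⟩ := h
  exact h.p_pos y hy

omit [IsManifold (𝓡 4) ∞ M] in
theorem ContMDiffOn.log_of_ne_zero {q : M → ℝ} (hq : ContMDiffOn (𝓡 4) 𝓘(ℝ) ∞ q U)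
    (h0 : ∀ y ∈ U, q y ≠ 0) : ContMDiffOn (𝓡 4) 𝓘(ℝ) ∞ (fun y ↦ Real.log (q y)) U :=
  fun y hy ↦ (Real.contDiffAt_log.2 (h0 y hy)).contMDiffAt.comp_contMDiffWithinAt y (hq y hy)

theorem IsCIGOn.mvfderiv_log_pressure (h : IsCIGOn g cov u U γ ρ p n) (hU : IsOpen U)
    (hf : ∀ y ∈ U, f y = 1 / γ * (ρ y / p y + 1)) {y : M} (hy : y ∈ U) :
    mvfderiv (𝓡 4) (fun z ↦ Real.log (p z)) y = γ • kinematicForm g cov u f y := by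
  have hp := h.pressure_pos hy
  rw [mvfderiv_comp_of_hasDerivAt (Real.hasDerivAt_log hp.ne')
    (h.smooth_pressure.mdifferentiableAt_of_isOpen hU hy), h.mvfderiv_pressure hU hf hy, smul_smul]
  congr 1
  field_simp

theorem IsCIGOn.contMDiffOn_indicatrix (h : IsCIGOn g cov u U γ ρ p n)
    (hf : ∀ y ∈ U, f y = 1 / γ * (ρ y / p y + 1)) : ContMDiffOn (𝓡 4) 𝓘(ℝ) ∞ f U :=
  (contMDiffOn_const.mul ((h.smooth_density.div₀ h.smooth_pressure
    fun _ hy ↦ (h.pressure_pos hy).ne').add contMDiffOn_const)).congr hf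

/-- Differentiate `γ f p = ρ + p` along `u`, insert the evolution of `ρ` and `p`, and divide by `γ
p`. -/
theorem IsCIGOn.dotDeriv_indicatrix (h : IsCIGOn g cov u U γ ρ p n) (hU : IsOpen U)
    (hf : ∀ y ∈ U, f y = 1 / γ * (ρ y / p y + 1)) {y : M} (hy : y ∈ U) :
    dotDeriv u f y = expansion cov u y * ((γ - 1) * f y - 1) := by
  have hγ := h.one_lt
  have hfp : ∀ z ∈ U, γ * (f z * p z) = ρ z + p z := fun z hz ↦ by
    have := (h.pressure_pos hz).ne'
    rw [hf z hz]
    field_simp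
  have hp := h.smooth_pressure.mdifferentiableAt_of_isOpen hU hy
  have hρ := h.smooth_density.mdifferentiableAt_of_isOpen hU hy
  have hfd := (h.contMDiffOn_indicatrix hf).mdifferentiableAt_of_isOpen hU hy
  have hev : (fun z ↦ γ * (f z * p z)) =ᶠ[𝓝 y] fun z ↦ ρ z + p z := by
    filter_upwards [hU.mem_nhds hy] with z hz using hfp z hz
  have hfpd : MDifferentiableAt (𝓡 4) 𝓘(ℝ) (fun z ↦ f z * p z) y := hfd.mul hp
  have h1 := congrArg (fun L : TangentSpace (𝓡 4) y →L[ℝ] ℝ ↦ L (u y)) hev.mvfderiv_eq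
  rw [mvfderiv_const_mul _ hfpd, mvfderiv_fun_mul hfd hp, mvfderiv_fun_add hρ hp] at h1
  change γ * (f y * dotDeriv u p y + p y * dotDeriv u f y) =
    dotDeriv u ρ y + dotDeriv u p y at h1
  have h2 := h.dotDeriv_pressure hU hy
  have h4 := hfp y hy
  have hp0 := (h.pressure_pos hy).ne'
  obtain ⟨k, cv, ε, s, T, h, -⟩ := h
  have h3 := h.energy y hy
  have hne : γ * p y ≠ 0 := mul_ne_zero (by linarith) hp0
  apply mul_left_cancel₀ hne
  linear_combination h1 - (γ * f y - 1) * h2 + h3 + expansion cov u y * h4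

theorem gammaTilde_eq_iff {c : ℝ} {y : M} (hθ : expansion cov u y ≠ 0) (hf : f y ≠ 0) :
    gammaTilde cov u f y = c ↔ dotDeriv u f y = expansion cov u y * (c * f y - 1) := by
  rw [gammaTilde]
  field_simp
  constructor <;> intro h <;> linear_combination h

/-- The indicatrix function of a classical ideal gas. -/
theorem IsCIGOn.isAdmissibleOn (hθ : ∀ x, expansion cov u x ≠ 0)
    (h : IsCIGOn g cov u U γ ρ p n) (hU : IsOpen U)
    (hf : ∀ y ∈ U, f y = 1 / γ * (ρ y / p y + 1)) :
    IsAdmissibleOn g cov u U f ∧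
      ∀ y ∈ U, (0 < n y ↔ 0 < dotDeriv u f y / expansion cov u y) := by
  have hγ := h.one_lt
  -- This factorization carries both the non-vanishing of `ḟ` and the sign criterion: the factor in
  -- front of `n` is positive.
  have hfn : ∀ y ∈ U, (γ - 1) * f y - 1 = (γ - 1) / (γ * p y) * n y := fun y hy ↦ by
    have := (h.pressure_pos hy).ne'
    have : γ - 1 ≠ 0 := by linarith
    rw [hf y hy, h.matter_eq hy]
    field_simp
    ring
  have hpos : ∀ y ∈ U, 0 < (γ - 1) / (γ * p y) := fun y hy ↦
    div_pos (by linarith) (mul_pos (by linarith) (h.pressure_pos hy))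
  refine ⟨⟨h.contMDiffOn_indicatrix hf, fun y hy ↦ ?_, fun y hy ↦ ?_, ?_⟩, fun y hy ↦ ?_⟩
  · have hp := (h.pressure_pos hy).ne'
    have hne : ρ y + p y ≠ 0 := by
      obtain ⟨k, cv, ε, s, T, h, -⟩ := h
      exact h.enthalpy_ne_zero y hy
    rw [hf y hy, div_add_one hp]
    exact mul_ne_zero (one_div_ne_zero (by linarith)) (div_ne_zero hne hp)
  · rw [h.dotDeriv_indicatrix hU hf hy, hfn y hy]
    exact mul_ne_zero (hθ y) (mul_ne_zero (hpos y hy).ne' (h.matter_ne_zero hy))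
  · have hlog := h.smooth_pressure.log_of_ne_zero fun y hy ↦ (h.pressure_pos hy).ne'
    refine isClosedFormOn_of_mvfderiv_eq hU (ψ := fun y ↦ γ⁻¹ * Real.log (p y))
      (contMDiffOn_const.mul hlog) fun y hy ↦ ?_
    rw [mvfderiv_const_mul _ (hlog.mdifferentiableAt_of_isOpen hU hy),
      h.mvfderiv_log_pressure hU hf hy, smul_smul, inv_mul_cancel₀ (by linarith), one_smul]
  · rw [h.dotDeriv_indicatrix hU hf hy, hfn y hy, mul_div_cancel_left₀ _ (hθ y)]
    exact (mul_pos_iff_of_pos_left (hpos y hy)).symm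

/-- The gas determined by an indicatrix function and a potential of its kinematic form. -/
theorem exists_isCIGOn (hcov : IsLeviCivita g cov) (hu : IsUnitTimelike g u)
    (hU : IsOpen U) (hγ : 1 < γ)
    (hf : IsAdmissibleOn g cov u U f)
    (hdot : ∀ y ∈ U, dotDeriv u f y = expansion cov u y * ((γ - 1) * f y - 1))
    (hψs : ContMDiffOn (𝓡 4) 𝓘(ℝ) ∞ ψ U)
    (hψ : ∀ y ∈ U, mvfderiv (𝓡 4) ψ y = kinematicForm g cov u f y)
    {C : ℝ} (hC : 0 < C)
    (hp : ∀ y ∈ U, p y = C * Real.exp (γ * ψ y)) (hρ : ∀ y ∈ U, ρ y = p y * (γ * f y - 1)) :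
    ∃ n : M → ℝ, IsCIGOn g cov u U γ ρ p n := by
  have hγ1 : γ - 1 ≠ 0 := by linarith
  have hγ0 : γ ≠ 0 := by linarith
  have hp0 : ∀ y ∈ U, 0 < p y := fun y hy ↦ by
    rw [hp y hy]
    positivity
  have hps : ContMDiffOn (𝓡 4) 𝓘(ℝ) ∞ p U :=
    (contMDiffOn_const.mul (Real.contDiff_exp.contMDiff.comp_contMDiffOn
      (contMDiffOn_const.mul hψs))).congr hp
  have hρs : ContMDiffOn (𝓡 4) 𝓘(ℝ) ∞ ρ U :=
    (hps.mul ((contMDiffOn_const.mul hf.smooth).sub contMDiffOn_const)).congr hρ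
  -- `n` is forced by `IsCIGOn.matter_eq`, and `T` by `p = k n T` with the normalization `k = γ -
  -- 1`.
  let n : M → ℝ := fun y ↦ ρ y - (γ - 1)⁻¹ * p y
  let T : M → ℝ := fun y ↦ p y / ((γ - 1) * n y)
  have hns : ContMDiffOn (𝓡 4) 𝓘(ℝ) ∞ n U := hρs.sub (contMDiffOn_const.mul hps)
  have hn0 : ∀ y ∈ U, n y ≠ 0 := fun y hy h0 ↦ hf.dot_ne_zero y hy <| by
    have h1 : n y = p y * γ / (γ - 1) * ((γ - 1) * f y - 1) := by
      change ρ y - (γ - 1)⁻¹ * p y = _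
      rw [hρ y hy]
      field_simp
      ring
    have h2 : p y * γ / (γ - 1) ≠ 0 := div_ne_zero (mul_ne_zero (hp0 y hy).ne' hγ0) hγ1
    rw [hdot y hy, (mul_eq_zero.1 (h1.symm.trans h0)).resolve_left h2, mul_zero]
  have hT0 : ∀ y ∈ U, T y ≠ 0 := fun y hy ↦
    div_ne_zero (hp0 y hy).ne' (mul_ne_zero hγ1 (hn0 y hy))
  have hTs : ContMDiffOn (𝓡 4) 𝓘(ℝ) ∞ T U :=
    hps.div₀ (contMDiffOn_const.mul hns) fun y hy ↦ mul_ne_zero hγ1 (hn0 y hy)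
  have hdp : ∀ y ∈ U, mvfderiv (𝓡 4) p y = (γ * p y) • kinematicForm g cov u f y := fun y hy ↦ by
    have hev : p =ᶠ[𝓝 y] fun z ↦ C * Real.exp (γ * ψ z) := by
      filter_upwards [hU.mem_nhds hy] with z hz using hp z hz
    have hd : HasDerivAt (fun t ↦ C * Real.exp (γ * t)) (γ * p y) (ψ y) := by
      rw [hp y hy]
      exact (((hasDerivAt_id (ψ y)).const_mul γ).exp.const_mul C).congr_deriv
        (by simp only [id, mul_one]; ring)
    rw [hev.mvfderiv_eq, mvfderiv_comp_of_hasDerivAt hd (hψs.mdifferentiableAt_of_isOpen hU hy),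
      hψ y hy]
  have hdotp : ∀ y ∈ U, dotDeriv u p y = - (γ * p y * expansion cov u y) := fun y hy ↦ by
    rw [dotDeriv, hdp y hy]
    change γ * p y * kinematicForm g cov u f y (u y) = _
    rw [hcov.kinematicForm_self hu]
    ring
  have henergy : ∀ y ∈ U, dotDeriv u ρ y + (ρ y + p y) * expansion cov u y = 0 := fun y hy ↦ by
    have hpd := hps.mdifferentiableAt_of_isOpen hU hy
    have hfd := hf.smooth.mdifferentiableAt_of_isOpen hU hy
    have hcf : MDifferentiableAt (𝓡 4) 𝓘(ℝ) (fun z ↦ γ * f z) y := mdifferentiableAt_const.mul hfd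
    have hev : ρ =ᶠ[𝓝 y] fun z ↦ p z * (γ * f z) - p z := by
      filter_upwards [hU.mem_nhds hy] with z hz
      rw [hρ z hz]
      ring
    have h1 := congrArg (fun L : TangentSpace (𝓡 4) y →L[ℝ] ℝ ↦ L (u y)) hev.mvfderiv_eq
    have hpcf : MDifferentiableAt (𝓡 4) 𝓘(ℝ) (fun z ↦ p z * (γ * f z)) y := hpd.mul hcf
    rw [mvfderiv_fun_sub hpcf hpd, mvfderiv_fun_mul hpd hcf, mvfderiv_const_mul _ hfd] at h1
    change dotDeriv u ρ y = p y * (γ * dotDeriv u f y) + γ * f y * dotDeriv u p y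
      - dotDeriv u p y at h1
    rw [h1, hdotp y hy, hdot y hy, hρ y hy]
    ring
  -- Only `k / cv` is prescribed, so `cv = 1` and `ε = T`. The entropy integrates `dT / T - (γ - 1)
  -- dn / n`; `Real.log` is the logarithm of the absolute value, so negative `n` and `T` are
  -- covered.
  refine ⟨n, γ - 1, 1, T, fun y ↦ Real.log (T y) - (γ - 1) * Real.log (n y), T, ?_, by ring⟩
  have hlT := hTs.log_of_ne_zero hT0
  have hln := hns.log_of_ne_zero hn0
  refine
    { k_pos := by linarith
      cv_pos := one_pos
      smooth_ρ := hρs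
      smooth_p := hps
      smooth_n := hns
      smooth_ε := hTs
      smooth_s := hlT.sub (contMDiffOn_const.mul hln)
      smooth_T := hTs
      momentum := fun y hy ↦ ?_
      energy := henergy
      enthalpy_ne_zero := fun y hy ↦ ?_
      decomposition := fun y hy ↦ ?_
      matter := fun y hy ↦ ?_
      equilibrium := fun y hy ↦ ?_
      state_p := fun y hy ↦ ?_
      p_pos := hp0
      state_ε := fun y _ ↦ (one_mul _).symm }
  · rw [hdp y hy, hdotp y hy, hρ y hy, kinematicForm]
    module
  · rw [hρ y hy, show p y * (γ * f y - 1) + p y = p y * (γ * f y) by ring]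
    exact mul_ne_zero (hp0 y hy).ne' (mul_ne_zero hγ0 (hf.ne_zero y hy))
  · have h1 := hn0 y hy
    have h2 : n y * T y = (γ - 1)⁻¹ * p y := by
      change n y * (p y / ((γ - 1) * n y)) = _
      field_simp
    rw [mul_one_add, h2]
    exact (sub_add_cancel _ _).symm
  · have hpd := hps.mdifferentiableAt_of_isOpen hU hy
    have hρd := hρs.mdifferentiableAt_of_isOpen hU hy
    have hcp : MDifferentiableAt (𝓡 4) 𝓘(ℝ) (fun z ↦ (γ - 1)⁻¹ * p z) y :=
      mdifferentiableAt_const.mul hpd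
    have h1 : dotDeriv u n y = dotDeriv u ρ y - (γ - 1)⁻¹ * dotDeriv u p y := by
      rw [dotDeriv, mvfderiv_fun_sub hρd hcp, mvfderiv_const_mul _ hpd]
      rfl
    have h2 := henergy y hy
    change _ + (ρ y - (γ - 1)⁻¹ * p y) * _ = 0
    rw [h1, hdotp y hy]
    field_simp
    linear_combination (γ - 1) * h2
  · have hTd := hTs.mdifferentiableAt_of_isOpen hU hy
    have hnd := hns.mdifferentiableAt_of_isOpen hU hy
    have hlTd := hlT.mdifferentiableAt_of_isOpen hU hy
    have hlnd := hln.mdifferentiableAt_of_isOpen hU hy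
    have hcl : MDifferentiableAt (𝓡 4) 𝓘(ℝ) (fun z ↦ (γ - 1) * Real.log (n z)) y :=
      mdifferentiableAt_const.mul hlnd
    have hinv : HasDerivAt (fun t : ℝ ↦ 1 / t) (-(n y ^ 2)⁻¹) (n y) := by
      simpa using hasDerivAt_inv (hn0 y hy)
    rw [mvfderiv_fun_sub hlTd hcl, mvfderiv_const_mul _ hlnd,
      mvfderiv_comp_of_hasDerivAt (Real.hasDerivAt_log (hT0 y hy)) hTd,
      mvfderiv_comp_of_hasDerivAt (Real.hasDerivAt_log (hn0 y hy)) hnd,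
      mvfderiv_comp_of_hasDerivAt hinv hnd, smul_sub, smul_smul, smul_smul, smul_smul, smul_smul,
      mul_inv_cancel₀ (hT0 y hy), one_smul, sub_eq_add_neg, ← neg_smul]
    -- The `dT` terms agree; what remains is the coefficient identity `-(γ - 1) T / n = -p / n²`.
    congr 2
    have h1 := hn0 y hy
    change -(p y / ((γ - 1) * n y) * (γ - 1) * (n y)⁻¹) = _
    field_simp
  · have h1 := hn0 y hy
    change _ = (γ - 1) * n y * (p y / ((γ - 1) * n y))
    field_simp

end
-- Local existence of the gas and uniqueness of its pressure up to a factor.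
section
variable {M : Type*} [TopologicalSpace M] [ChartedSpace (EuclideanSpace ℝ (Fin 4)) M]
  [IsManifold (𝓡 4) ∞ M] {g : LorentzMetric M}
    {cov : CovariantDerivative (𝓡 4) (EuclideanSpace ℝ (Fin 4)) (TangentSpace (𝓡 4) : M → Type _)}
    {u : Π x : M, TangentSpace (𝓡 4) x} {U V : Set M} {γ : ℝ} {ρ p n f ψ : M → ℝ}

theorem IsAdmissibleOn.mono (h : IsAdmissibleOn g cov u U f) (hVU : V ⊆ U) :
    IsAdmissibleOn g cov u V f where
  smooth := h.smooth.mono hVU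
  ne_zero y hy := h.ne_zero y (hVU hy)
  dot_ne_zero y hy := h.dot_ne_zero y (hVU hy)
  closed y hy := h.closed y (hVU hy)

theorem IsAdmissibleOn.exists_potential (hcov : IsLeviCivita g cov) (hu : IsUnitTimelike g u)
    (hU : IsOpen U) (hf : IsAdmissibleOn g cov u U f) {x : M} (hx : x ∈ U) :
    ∃ V : Set M, IsOpen V ∧ x ∈ V ∧ V ⊆ U ∧ ∃ ψ : M → ℝ, ContMDiffOn (𝓡 4) 𝓘(ℝ) ∞ ψ V ∧
      ∀ y ∈ V, mvfderiv (𝓡 4) ψ y = kinematicForm g cov u f y :=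
  hf.closed.exists_mvfderiv_eq hU (fun _ hy _ hX ↦
    hcov.contMDiffAt_kinematicForm hu (hf.smooth.contMDiffAt (hU.mem_nhds hy)) hX) hx

theorem IsAdmissibleOn.exists_local_gas (hcov : IsLeviCivita g cov) (hu : IsUnitTimelike g u)
    (hU : IsOpen U) (hγ : 1 < γ) (hf : IsAdmissibleOn g cov u U f)
    (hdot : ∀ y ∈ U, dotDeriv u f y = expansion cov u y * ((γ - 1) * f y - 1))
    {x : M} (hx : x ∈ U) :
    ∃ V : Set M, IsOpen V ∧ x ∈ V ∧ V ⊆ U ∧ ∃ ρ p n : M → ℝ, IsCIGOn g cov u V γ ρ p n ∧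
      ∀ y ∈ V, f y = 1 / γ * (ρ y / p y + 1) := by
  obtain ⟨V, hV, hxV, hVU, ψ, hψs, hψ⟩ := hf.exists_potential hcov hu hU hx
  -- Any positive `C` would do.
  obtain ⟨n, hn⟩ := exists_isCIGOn (C := 1) (p := fun y ↦ 1 * Real.exp (γ * ψ y))
    (ρ := fun y ↦ 1 * Real.exp (γ * ψ y) * (γ * f y - 1)) hcov hu hV hγ (hf.mono hVU)
    (fun y hy ↦ hdot y (hVU hy)) hψs hψ one_pos (fun _ _ ↦ rfl) (fun _ _ ↦ rfl)
  refine ⟨V, hV, hxV, hVU, _, _, n, hn, fun y _ ↦ ?_⟩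
  field_simp
  ring

/-- The pressure of a gas is an exponential of a potential of the kinematic form. -/
theorem IsCIGOn.exists_pressure_eq (h : IsCIGOn g cov u V γ ρ p n) (hV : IsOpen V)
    (hVc : IsConnected V) (hf : ∀ y ∈ V, f y = 1 / γ * (ρ y / p y + 1))
    (hψs : ContMDiffOn (𝓡 4) 𝓘(ℝ) ∞ ψ V)
    (hψ : ∀ y ∈ V, mvfderiv (𝓡 4) ψ y = kinematicForm g cov u f y) :
    ∃ C : ℝ, 0 < C ∧ ∀ y ∈ V, p y = C * Real.exp (γ * ψ y) := by
  have hlog := h.smooth_pressure.log_of_ne_zero fun y hy ↦ (h.pressure_pos hy).ne'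
  have hcψ : ContMDiffOn (𝓡 4) 𝓘(ℝ) ∞ (fun y ↦ γ * ψ y) V := contMDiffOn_const.mul hψs
  obtain ⟨x, hx⟩ := hVc.nonempty
  -- The constant is fixed by the value of `log p - γ ψ` at a base point.
  refine ⟨Real.exp (Real.log (p x) - γ * ψ x), Real.exp_pos _, fun y hy ↦ ?_⟩
  have heq := hV.eq_of_mvfderiv_eq_zero (I := 𝓡 4) hVc.isPreconnected
    (q := fun y ↦ Real.log (p y) - γ * ψ y)
    (fun y hy ↦ ((hlog.sub hcψ).contMDiffAt (hV.mem_nhds hy)).of_le (by simp))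
    (fun y hy ↦ by
      rw [mvfderiv_fun_sub (hlog.mdifferentiableAt_of_isOpen hV hy)
        (hcψ.mdifferentiableAt_of_isOpen hV hy), h.mvfderiv_log_pressure hV hf hy,
        mvfderiv_const_mul _ (hψs.mdifferentiableAt_of_isOpen hV hy), hψ y hy, sub_self]) hx hy
  rw [heq, ← Real.exp_add, sub_add_cancel, Real.exp_log (h.pressure_pos hy)]

end

/-! ### Assembly of the four statements. -/

theorem mainTheorem3 {M : Type*} [TopologicalSpace M]
    [ChartedSpace (EuclideanSpace ℝ (Fin 4)) M]
    [IsManifold (𝓡 4) ∞ M] (g : LorentzMetric M)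
    (cov : CovariantDerivative (𝓡 4) (EuclideanSpace ℝ (Fin 4)) (TangentSpace (𝓡 4) : M → Type _))
    (hcov : IsLeviCivita g cov)
    (u : Π x : M, TangentSpace (𝓡 4) x) (hu : IsUnitTimelike g u)
    (hθ : ∀ x, expansion cov u x ≠ 0) :
    -- characterization for a given adiabatic index
    (∀ γ : ℝ, 1 < γ → ∀ x : M,
      (IsCIGVelocityAt g cov u γ x ↔
        ∃ U : Set M, IsOpen U ∧ x ∈ U ∧ ∃ f : M → ℝ, IsAdmissibleOn g cov u U f ∧
          ∀ y ∈ U, dotDeriv u f y = expansion cov u y * ((γ - 1) * f y - 1)) ∧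
      (IsPositiveCIGVelocityAt g cov u γ x ↔
        ∃ U : Set M, IsOpen U ∧ x ∈ U ∧ ∃ f : M → ℝ, IsAdmissibleOn g cov u U f ∧
          (∀ y ∈ U, dotDeriv u f y = expansion cov u y * ((γ - 1) * f y - 1)) ∧
          ∀ y ∈ U, 0 < dotDeriv u f y / expansion cov u y)) ∧
    -- characterization for an unspecified adiabatic index
    (∀ x : M,
      ((∃ γ : ℝ, IsCIGVelocityAt g cov u γ x) ↔
        ∃ U : Set M, IsOpen U ∧ x ∈ U ∧ ∃ f : M → ℝ, IsAdmissibleOn g cov u U f ∧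
          ∃ c : ℝ, 0 < c ∧ ∀ y ∈ U, gammaTilde cov u f y = c) ∧
      ((∃ γ : ℝ, IsPositiveCIGVelocityAt g cov u γ x) ↔
        ∃ U : Set M, IsOpen U ∧ x ∈ U ∧ ∃ f : M → ℝ, IsAdmissibleOn g cov u U f ∧
          (∃ c : ℝ, 0 < c ∧ ∀ y ∈ U, gammaTilde cov u f y = c) ∧
          ∀ y ∈ U, 0 < dotDeriv u f y / expansion cov u y)) ∧
    -- the function `f` of a given gas, on the whole domain of the gas
    (∀ U : Set M, IsOpen U → ∀ (γ : ℝ) (ρ p n f : M → ℝ), IsCIGOn g cov u U γ ρ p n →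
      (∀ y ∈ U, f y = 1 / γ * (ρ y / p y + 1)) →
      IsAdmissibleOn g cov u U f ∧
      (∀ y ∈ U, dotDeriv u f y = expansion cov u y * ((γ - 1) * f y - 1)) ∧
      (∀ y ∈ U, gammaTilde cov u f y = γ - 1) ∧
      ∀ y ∈ U, (0 < n y ↔ 0 < dotDeriv u f y / expansion cov u y)) ∧
    -- determination of the gas by the pair `(u, f)`
    (∀ U : Set M, IsOpen U → ∀ (f : M → ℝ) (c : ℝ), IsAdmissibleOn g cov u U f → 0 < c →
      (∀ y ∈ U, gammaTilde cov u f y = c) →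
      (∀ x ∈ U, ∃ V : Set M, IsOpen V ∧ x ∈ V ∧ V ⊆ U ∧ ∃ ψ : M → ℝ,
        ContMDiffOn (𝓡 4) 𝓘(ℝ) ∞ ψ V ∧
        ∀ y ∈ V, mvfderiv (𝓡 4) ψ y = kinematicForm g cov u f y) ∧
      (∀ V : Set M, IsOpen V → IsConnected V → V ⊆ U → ∀ ψ : M → ℝ,
        ContMDiffOn (𝓡 4) 𝓘(ℝ) ∞ ψ V →
        (∀ y ∈ V, mvfderiv (𝓡 4) ψ y = kinematicForm g cov u f y) →
        ∀ (γ : ℝ) (ρ p : M → ℝ),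
          ((∃ n : M → ℝ, IsCIGOn g cov u V γ ρ p n) ∧
              ∀ y ∈ V, f y = 1 / γ * (ρ y / p y + 1)) ↔
            (γ = c + 1 ∧ ∃ C : ℝ, 0 < C ∧
              ∀ y ∈ V, p y = C * Real.exp (γ * ψ y) ∧ ρ y = p y * (γ * f y - 1)))) := by
  -- Constancy of `γ̃` is the evolution equation of `f` with `γ - 1 = c`; the form `c + 1 - 1`
  -- matches the index `γ = c + 1`.
  have hdotc : ∀ {U : Set M} {f : M → ℝ} {c : ℝ}, IsAdmissibleOn g cov u U f →
      (∀ y ∈ U, gammaTilde cov u f y = c) → ∀ y ∈ U,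
        dotDeriv u f y = expansion cov u y * ((c + 1 - 1) * f y - 1) := fun {U f c} hf h y hy ↦ by
    rw [add_sub_cancel_right]
    exact (gammaTilde_eq_iff (hθ y) (hf.ne_zero y hy)).1 (h y hy)
  have hgam : ∀ {U : Set M} {f : M → ℝ} {γ : ℝ}, IsAdmissibleOn g cov u U f →
      (∀ y ∈ U, dotDeriv u f y = expansion cov u y * ((γ - 1) * f y - 1)) →
        ∀ y ∈ U, gammaTilde cov u f y = γ - 1 := fun {U f γ} hf h y hy ↦
    (gammaTilde_eq_iff (hθ y) (hf.ne_zero y hy)).2 (h y hy)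
  have hfwd : ∀ {U : Set M} {γ : ℝ} {ρ p n : M → ℝ}, IsOpen U → IsCIGOn g cov u U γ ρ p n →
      ∃ f : M → ℝ, IsAdmissibleOn g cov u U f ∧
        (∀ y ∈ U, dotDeriv u f y = expansion cov u y * ((γ - 1) * f y - 1)) ∧
        ∀ y ∈ U, (0 < n y ↔ 0 < dotDeriv u f y / expansion cov u y) :=
    fun {U γ ρ p n} hU h ↦
      have hf := fun y (_ : y ∈ U) ↦ (rfl : 1 / γ * (ρ y / p y + 1) = 1 / γ * (ρ y / p y + 1))
      have ha := h.isAdmissibleOn hθ hU hf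
      ⟨fun y ↦ 1 / γ * (ρ y / p y + 1), ha.1, fun _ hy ↦ h.dotDeriv_indicatrix hU hf hy, ha.2⟩
  have hbwd : ∀ {U : Set M} {γ : ℝ} {f : M → ℝ} {x : M}, IsOpen U → x ∈ U → 1 < γ →
      IsAdmissibleOn g cov u U f →
      (∀ y ∈ U, dotDeriv u f y = expansion cov u y * ((γ - 1) * f y - 1)) →
      IsCIGVelocityAt g cov u γ x ∧
        ((∀ y ∈ U, 0 < dotDeriv u f y / expansion cov u y) →
          IsPositiveCIGVelocityAt g cov u γ x) := by
    intro U γ f x hU hx hγ hf hdot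
    obtain ⟨V, hV, hxV, hVU, ρ, p, n, hn, hfV⟩ := hf.exists_local_gas hcov hu hU hγ hdot hx
    -- The constructed gas has indicatrix `f`, so the sign criterion turns `ḟ / θ > 0` back into `n
    -- > 0`.
    exact ⟨⟨V, hV, hxV, ρ, p, n, hn⟩, fun hpos ↦ ⟨V, hV, hxV, ρ, p, n, hn, fun y hy ↦
      ((hn.isAdmissibleOn hθ hV hfV).2 y hy).2 (hpos y (hVU hy))⟩⟩
  refine ⟨fun γ hγ x ↦ ⟨⟨?_, ?_⟩, ⟨?_, ?_⟩⟩, fun x ↦ ⟨⟨?_, ?_⟩, ⟨?_, ?_⟩⟩, ?_, ?_⟩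
  · rintro ⟨U, hU, hx, ρ, p, n, h⟩
    obtain ⟨f, hf, hdot, -⟩ := hfwd hU h
    exact ⟨U, hU, hx, f, hf, hdot⟩
  · rintro ⟨U, hU, hx, f, hf, hdot⟩
    exact (hbwd hU hx hγ hf hdot).1
  · rintro ⟨U, hU, hx, ρ, p, n, h, hn⟩
    obtain ⟨f, hf, hdot, hpos⟩ := hfwd hU h
    exact ⟨U, hU, hx, f, hf, hdot, fun y hy ↦ (hpos y hy).1 (hn y hy)⟩
  · rintro ⟨U, hU, hx, f, hf, hdot, hpos⟩
    exact (hbwd hU hx hγ hf hdot).2 hpos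
  · rintro ⟨γ, U, hU, hx, ρ, p, n, h⟩
    obtain ⟨f, hf, hdot, -⟩ := hfwd hU h
    exact ⟨U, hU, hx, f, hf, γ - 1, sub_pos.2 h.one_lt, hgam hf hdot⟩
  · rintro ⟨U, hU, hx, f, hf, c, hc, hfc⟩
    exact ⟨c + 1, (hbwd hU hx (by linarith) hf (hdotc hf hfc)).1⟩
  · rintro ⟨γ, U, hU, hx, ρ, p, n, h, hn⟩
    obtain ⟨f, hf, hdot, hpos⟩ := hfwd hU h
    exact ⟨U, hU, hx, f, hf, ⟨γ - 1, sub_pos.2 h.one_lt, hgam hf hdot⟩,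
      fun y hy ↦ (hpos y hy).1 (hn y hy)⟩
  · rintro ⟨U, hU, hx, f, hf, ⟨c, hc, hfc⟩, hpos⟩
    exact ⟨c + 1, (hbwd hU hx (by linarith) hf (hdotc hf hfc)).2 hpos⟩
  · intro U hU γ ρ p n f h hf
    have ha := h.isAdmissibleOn hθ hU hf
    have hdot := fun y (hy : y ∈ U) ↦ h.dotDeriv_indicatrix hU hf hy
    exact ⟨ha.1, hdot, hgam ha.1 hdot, ha.2⟩
  · intro U hU f c hf hc hfc
    refine ⟨fun x hx ↦ hf.exists_potential hcov hu hU hx, ?_⟩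
    intro V hV hVc hVU ψ hψs hψ γ ρ p
    constructor
    · rintro ⟨⟨n, h⟩, hfV⟩
      have hγ := h.one_lt
      obtain ⟨C, hC, hp⟩ := h.exists_pressure_eq hV hVc hfV hψs hψ
      obtain ⟨x, hx⟩ := hVc.nonempty
      -- Comparing the two values of `γ̃` at one point of the non-empty `V` identifies `γ` with `c +
      -- 1`.
      have h1 := hgam (hf.mono hVU) (fun y hy ↦ h.dotDeriv_indicatrix hV hfV hy) x hx
      refine ⟨by linarith [hfc x (hVU hx)], C, hC, fun y hy ↦ ⟨hp y hy, ?_⟩⟩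
      have := (h.pressure_pos hy).ne'
      rw [hfV y hy]
      field_simp
      ring
    · rintro ⟨rfl, C, hC, hpρ⟩
      refine ⟨exists_isCIGOn hcov hu hV (by linarith) (hf.mono hVU)
        (fun y hy ↦ hdotc hf hfc y (hVU hy)) hψs hψ hC (fun y hy ↦ (hpρ y hy).1)
        (fun y hy ↦ (hpρ y hy).2), fun y hy ↦ ?_⟩
      have hp0 : p y ≠ 0 := by
        rw [(hpρ y hy).1]
        positivity
      have hc1 : c + 1 ≠ 0 := by positivity
      rw [(hpρ y hy).2]
      field_simp
      ring
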